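/- Let $k$ be a field and let $S$ be a finite partially ordered set. An $S$-space is a family $\mathbf V=(V,V(s))_{s\in S}$, where $V$ is a finite-dimensional $k$-vector space and the $V(s)$ are subspaces of $V$ with $V(s)\subseteq V(t)$ whenever $s\le t$. A morphism $\mathbf U\to\mathbf V$ is a $k$-linear map $f:U\to V$ with $f(U(s))\subseteq V(s)$ for all $s$, and $\mathbf U\oplus\mathbf V=(U\oplus V,\,U(s)\oplus V(s))_{s\in S}$. An $S$-space is indecomposable if it is nonzero and not isomorphic to a direct sum of two nonzero $S$-spaces. Let $\nu(S)$ be the cardinality of the set of isomorphism classes of indecomposable $S$-spaces over $k$; $S$ is finitely represented if $\nu(S)$ is finite. For a finite poset $T$, let $w(T)$ be the largest cardinality of an antichain of $T$, and let $a(T)$ be the set of nonempty antichains of $T$. Let $\check a(T)$ denote $a(T)$ ordered by: $A\le B$ if and only if for every $a\in A$ there is $b\in B$ with $a\le b$. Identify $s\in T$ with $\{s\}\in\check a(T)$. For $p\in S$ put $(p)=\{s\in S: s\le p\}$ and $\langle p\rangle=\{s\in S: p\le s\}$, and let $$S^p=\bigl((p)\setminus\{p\}\bigr)\cup\check a\bigl(S\setminus[(p)\cup\langle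 p\rangle]\bigr)$$ with the order induced from $\check a(S)$. If $p\in S$ satisfies $w(S\setminus(p))\le 2$, then $$\nu(S)=\nu(S^p)+\bigl|a(S\setminus(p))\bigr|+1$$ (as an equality of cardinal numbers). In particular, $S$ is finitely represented if and only if $S^p$ is finitely represented. -/

import Mathlib

universe u v

namespace PosetRep

/-! ### Antichains, width, and the derived poset -/

/-- The width of `S`: the largest cardinality of an antichain of `S`. -/
noncomputable def width (S : Type v) [PartialOrder S] : ℕ∞ :=
  ⨆ (A : Set S) (_ : IsAntichain (· ≤ ·) A), A.encard

/-- The set of nonempty antichains of `S`. -/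
@[ext] structure JoinAntichain (S : Type v) [PartialOrder S] where
  /-- The underlying subset of `S`. -/
  carrier : Set S
  isAntichain : IsAntichain (· ≤ ·) carrier
  nonempty : carrier.Nonempty

/-- The nonempty antichains with the order in which `A ≤ B` if and only if every element of `A`
lies below some element of `B`. -/
instance JoinAntichain.instPartialOrder (S : Type v) [PartialOrder S] :
    PartialOrder (JoinAntichain S) where
  le A B := ∀ a ∈ A.carrier, ∃ b ∈ B.carrier, a ≤ b
  le_refl _ a ha := ⟨a, ha, le_rfl⟩
  le_trans A B C hAB hBC a ha := by
    obtain ⟨b, hb, hab⟩ := hAB a ha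
    obtain ⟨c, hc, hbc⟩ := hBC b hb
    exact ⟨c, hc, hab.trans hbc⟩
  le_antisymm A B hAB hBA := by
    ext x
    constructor
    · intro hx
      obtain ⟨b, hb, hxb⟩ := hAB x hx
      obtain ⟨a, ha, hba⟩ := hBA b hb
      have hxa : x = a := A.isAntichain.eq hx ha (hxb.trans hba)
      subst hxa
      exact hxb.antisymm hba ▸ hb
    · intro hx
      obtain ⟨a, ha, hxa⟩ := hBA x hx
      obtain ⟨b, hb, hab⟩ := hAB a ha
      have hxb : x = b := B.isAntichain.eq hx hb (hxa.trans hab)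
      subst hxb
      exact hxa.antisymm hab ▸ ha

/-- An element of `S` viewed as the antichain that it forms. -/
def JoinAntichain.single {S : Type v} [PartialOrder S] (s : S) : JoinAntichain S where
  carrier := {s}
  isAntichain := Set.subsingleton_singleton.isAntichain _
  nonempty := Set.singleton_nonempty s

/-- The poset obtained from `S` by joining to the principal ideal `(p)` all nonempty antichains
of `S ∖ (p)`, as a subset of the poset of nonempty antichains of `S`. -/
def idealExtension {S : Type v} [PartialOrder S] (p : S) : Set (JoinAntichain S) :=
  (JoinAntichain.single '' Set.Iic p) ∪ {A | A.carrier ⊆ (Set.Iic p)ᶜ}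

/-- The derived poset `S^p` of `S` with respect to the principal ideal `(p)`: the elements
`s ≠ p` of `(p)` together with the nonempty antichains of elements incomparable to `p`, with the
order induced from the poset of nonempty antichains of `S`. -/
def derivedPoset {S : Type v} [PartialOrder S] (p : S) : Set (JoinAntichain S) :=
  (JoinAntichain.single '' (Set.Iic p \ {p})) ∪
    {A | A.carrier ⊆ (Set.Iic p ∪ Set.Ici p)ᶜ}

/-- The derived poset arises from `idealExtension p` by removing the principal filter generated
by `p`. -/
theorem derivedPoset_eq {S : Type v} [PartialOrder S] (p : S) :
    derivedPoset p = idealExtension p \ Set.Ici (JoinAntichain.single p) := by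
  have key : ∀ A : JoinAntichain S,
      JoinAntichain.single p ≤ A ↔ ∃ b ∈ A.carrier, p ≤ b := by
    intro A
    constructor
    · intro h
      exact h p rfl
    · rintro h x rfl
      exact h
  ext A
  simp only [derivedPoset, idealExtension, Set.mem_union, Set.mem_image, Set.mem_sdiff,
    Set.mem_Iic, Set.mem_singleton_iff, Set.mem_ofPred_eq, Set.mem_Ici, key]
  constructor
  · rintro (⟨s, ⟨hs, hsp⟩, rfl⟩ | hA)
    · refine ⟨Or.inl ⟨s, hs, rfl⟩, ?_⟩
      rintro ⟨b, rfl, hb⟩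
      exact hsp (le_antisymm hs hb)
    · refine ⟨Or.inr fun x hx h => hA hx (Or.inl h), ?_⟩
      rintro ⟨b, hb, hpb⟩
      exact hA hb (Or.inr hpb)
  · rintro ⟨⟨s, hs, rfl⟩ | hA, h⟩
    · exact Or.inl ⟨s, ⟨hs, fun e => h ⟨s, rfl, e.ge⟩⟩, rfl⟩
    · exact Or.inr fun x hx hx' => hx'.elim (hA hx) fun h' => h ⟨x, hx, h'⟩

/-! ### Representations of a poset -/

/-- An `S`-space over the field `k`: a finite dimensional vector space `V` with a subspace `V(s)`
for each `s ∈ S` such that `s ≤ t` implies `V(s) ⊆ V(t)`. -/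
structure Space (k : Type u) [Field k] (S : Type v) [PartialOrder S] where
  /-- The ambient space. -/
  ambient : Type u
  [addCommGroup : AddCommGroup ambient]
  [module : Module k ambient]
  [finiteDimensional : FiniteDimensional k ambient]
  /-- The subspaces. -/
  sub : S → Submodule k ambient
  mono : ∀ {s t : S}, s ≤ t → sub s ≤ sub t

attribute [instance] Space.addCommGroup Space.module Space.finiteDimensional

namespace Space

variable {k : Type u} [Field k] {S : Type v} [PartialOrder S]

/-- A linear map is a morphism `U ⟶ V` of `S`-spaces if it maps `U(s)` into `V(s)`. -/
def IsMorphism (U V : Space k S) (f : U.ambient →ₗ[k] V.ambient) : Prop :=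
  ∀ s : S, (U.sub s).map f ≤ V.sub s

/-- Two `S`-spaces are isomorphic if there are mutually inverse morphisms between them. -/
def Isomorphic (U V : Space k S) : Prop :=
  ∃ (f : U.ambient →ₗ[k] V.ambient) (g : V.ambient →ₗ[k] U.ambient),
    IsMorphism U V f ∧ IsMorphism V U g ∧ g ∘ₗ f = LinearMap.id ∧ f ∘ₗ g = LinearMap.id

/-- The direct sum of two `S`-spaces. -/
def directSum (U V : Space k S) : Space k S where
  ambient := U.ambient × V.ambient
  sub s := (U.sub s).prod (V.sub s)
  mono h := Submodule.prod_mono (U.mono h) (V.mono h)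

/-- An `S`-space is nonzero if its ambient space is. -/
def IsNonzero (V : Space k S) : Prop := Nontrivial V.ambient

/-- An `S`-space is indecomposable if it is nonzero and not isomorphic to a direct sum of two
nonzero `S`-spaces. -/
def Indecomposable (V : Space k S) : Prop :=
  V.IsNonzero ∧
    ¬ ∃ U W : Space k S, U.IsNonzero ∧ W.IsNonzero ∧ Isomorphic V (directSum U W)

variable (k S) in
/-- Isomorphism of `S`-spaces as an equivalence relation. -/
def isoSetoid : Setoid (Space k S) where
  r := Isomorphic
  iseqv :=
    { refl := fun U => ⟨LinearMap.id, LinearMap.id, fun s => by simp, fun s => by simp, rfl, rfl⟩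
      symm := fun ⟨f, g, hf, hg, hgf, hfg⟩ => ⟨g, f, hg, hf, hfg, hgf⟩
      trans := by
        rintro U V W ⟨f, g, hf, hg, hgf, hfg⟩ ⟨f', g', hf', hg', hgf', hfg'⟩
        refine ⟨f' ∘ₗ f, g ∘ₗ g', fun s => ?_, fun s => ?_, ?_, ?_⟩
        · rw [Submodule.map_comp]
          exact (Submodule.map_mono (hf s)).trans (hf' s)
        · rw [Submodule.map_comp]
          exact (Submodule.map_mono (hg' s)).trans (hg s)
        · rw [LinearMap.comp_assoc, ← LinearMap.comp_assoc f f' g', hgf', LinearMap.id_comp, hgf]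
        · rw [LinearMap.comp_assoc, ← LinearMap.comp_assoc g' g f, hfg, LinearMap.id_comp, hfg'] }

end Space

/-- The set of isomorphism classes of indecomposable `S`-spaces. -/
def indecomposableClasses (k : Type u) [Field k] (S : Type v) [PartialOrder S] :
    Set (Quotient (Space.isoSetoid k S)) :=
  Quotient.mk (Space.isoSetoid k S) '' {V | V.Indecomposable}

/-- The cardinality `ν(S)` of the set of isomorphism classes of indecomposable `S`-spaces. -/
noncomputable def nu (k : Type u) [Field k] (S : Type v) [PartialOrder S] : Cardinal :=
  Cardinal.mk (indecomposableClasses k S)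

/-- `S` is finitely represented over `k` if `ν(S)` is finite. -/
def FinitelyRepresented (k : Type u) [Field k] (S : Type v) [PartialOrder S] : Prop :=
  nu k S < Cardinal.aleph0

end PosetRep

namespace PosetRep

/-! ### Posets of width at most two -/

section Width

variable {T : Type v} [PartialOrder T]

/-! Indecomposables are sorted by whether V(p) vanishes.

If V(p) = 0, only the subspaces outside (p) matter. They are indexed by a poset of width at most
two, and such a family always splits off a line (`exists_splitting`). Hence V is one-dimensional and
is determined by the lower set on which it vanishes. The lower sets containing p correspond to the
antichains outside (p); the empty antichain accounts for the summand 1.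

If V(p) ≠ 0, passing to V(p) with its intersections with the sums of the V(a), a ∈ A, gives a
bijection onto the indecomposable S^p-spaces. Three facts carry this. Every morphism of derived
spaces extends (`exists_extension`): it is extended one dimension at a time, and the value at a
two-element antichain is exactly what reconciles the constraints at its two elements. By Fitting's
lemma, an endomorphism of an indecomposable space is nilpotent or injective; together with
extension, this shows that derivation preserves indecomposability and reflects isomorphism. Finally,
`thicken` builds an S-space with any prescribed derived space. -/

theorem comparable_of_width_le_two (h : width T ≤ 2) (a b c : T) :
    a ≤ b ∨ b ≤ a ∨ a ≤ c ∨ c ≤ a ∨ b ≤ c ∨ c ≤ b := by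
  by_contra! hn
  obtain ⟨h1, h2, h3, h4, h5, h6⟩ := hn
  have hA : IsAntichain (· ≤ ·) ({a, b, c} : Set T) := by
    rintro x (rfl | rfl | rfl) y (rfl | rfl | rfl) hxy <;> simp_all
  have hle : ({a, b, c} : Set T).encard ≤ 2 :=
    (le_iSup₂ (f := fun (A : Set T) (_ : IsAntichain (· ≤ ·) A) => A.encard) _ hA).trans h
  have h3 : ({a, b, c} : Set T).encard = 3 :=
    Set.encard_eq_three.2 ⟨a, b, c, fun e => h1 e.le, fun e => h3 e.le, fun e => h5 e.le, rfl⟩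
  rw [h3] at hle
  exact absurd hle (by decide)

/-- In a finite poset of width at most two, a proper lower set has at most two minimal
elements outside it, and these generate its complement. -/
theorem exists_generators_compl [Finite T] (h : width T ≤ 2) {D : Set T} (hD : D ≠ Set.univ) :
    ∃ r₁ r₂, Minimal (· ∉ D) r₁ ∧ Minimal (· ∉ D) r₂ ∧ (r₁ = r₂ ∨ (¬ r₁ ≤ r₂ ∧ ¬ r₂ ≤ r₁)) ∧
      ∀ s, s ∉ D → r₁ ≤ s ∨ r₂ ≤ s := by
  have key : ∀ s, s ∉ D → ∃ r ≤ s, Minimal (· ∉ D) r := fun s hs =>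
    (Set.toFinite Dᶜ).exists_le_minimal hs
  obtain ⟨x, hx⟩ := (Set.ne_univ_iff_exists_notMem D).1 hD
  obtain ⟨r₁, -, h₁⟩ := key x hx
  by_cases hall : ∀ s, s ∉ D → r₁ ≤ s
  · exact ⟨r₁, r₁, h₁, h₁, Or.inl rfl, fun s hs => Or.inl (hall s hs)⟩
  push Not at hall
  obtain ⟨s, hs, hrs⟩ := hall
  obtain ⟨r₂, hr₂, h₂⟩ := key s hs
  have h12 : ¬ r₁ ≤ r₂ := fun e => hrs (e.trans hr₂)
  refine ⟨r₁, r₂, h₁, h₂, Or.inr ⟨h12, fun e => h12 (h₁.2 h₂.1 e)⟩, fun t ht => ?_⟩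
  obtain ⟨r₃, hr₃, h₃⟩ := key t ht
  -- Comparable minimal elements coincide, so a third one must equal r₁ or r₂.
  rcases comparable_of_width_le_two h r₁ r₂ r₃ with e | e | e | e | e | e
  · exact absurd e h12
  · exact absurd (h₁.2 h₂.1 e) h12
  · exact Or.inl (e.trans hr₃)
  · exact Or.inl ((h₁.2 h₃.1 e).trans hr₃)
  · exact Or.inr (e.trans hr₃)
  · exact Or.inr ((h₂.2 h₃.1 e).trans hr₃)

/-- A family of subspaces indexed by a poset of width at most two splits off a line. -/
theorem exists_splitting [Finite T] (h : width T ≤ 2) {k : Type*} [Field k] {M : Type*}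
    [AddCommGroup M] [Module k M] {P X : Submodule k M} (hPX : P < X) {U : T → Submodule k M}
    (hU : Monotone U) (hP : ∀ t, P ≤ U t) (hX : ∀ t, U t ≤ X) :
    ∃ (D : Set T) (φ : M →ₗ[k] k) (u : M), IsLowerSet D ∧ u ∈ X ∧ φ u = 1 ∧
      P ≤ LinearMap.ker φ ∧ (∀ t ∈ D, U t ≤ LinearMap.ker φ) ∧ ∀ t ∉ D, u ∈ U t := by
  set B : Set T → Submodule k M := fun D => P ⊔ ⨆ t ∈ D, U t with hB
  have hBX : ∀ D, B D ≤ X := fun D => sup_le hPX.le (iSup₂_le fun t _ => hX t)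
  have hUB : ∀ D, ∀ t ∈ D, U t ≤ B D := fun D t ht =>
    (le_iSup₂ (f := fun t (_ : t ∈ D) => U t) t ht).trans le_sup_right
  have hne : {D : Set T | IsLowerSet D ∧ B D ≠ X}.Nonempty :=
    ⟨∅, isLowerSet_empty, by simpa [hB] using hPX.ne⟩
  -- D is maximal among the lower sets that do not yet span X; adding any minimal outside element r
  -- then gives all of X.
  obtain ⟨D, ⟨hD, hDX⟩, hmax⟩ := (Set.toFinite _).exists_maximal hne
  have hins : ∀ r, Minimal (· ∉ D) r → X ≤ B D ⊔ U r := by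
    intro r hr
    have hlow : IsLowerSet (insert r D) := by
      rintro a b hba (rfl | ha)
      · by_cases hb : b ∈ D
        · exact Or.inr hb
        · exact Or.inl (le_antisymm hba (hr.2 hb hba))
      · exact Or.inr (hD hba ha)
    have heq : B (insert r D) = X := by
      by_contra hc
      exact hr.1 (hmax ⟨hlow, hc⟩ (Set.subset_insert r D) (Set.mem_insert r D))
    rw [← heq]
    refine sup_le (le_sup_left.trans le_sup_left) (iSup₂_le ?_)
    rintro t (rfl | ht)
    · exact le_sup_right
    · exact (hUB D t ht).trans le_sup_left
  have hXB : ¬ X ≤ B D := fun e => hDX (le_antisymm (hBX D) e)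
  have hu : ∃ u ∈ X, u ∉ B D ∧ ∀ t ∉ D, u ∈ U t := by
    by_cases huniv : D = Set.univ
    · obtain ⟨u, hu, hu'⟩ := SetLike.not_le_iff_exists.1 hXB
      exact ⟨u, hu, hu', fun t ht => absurd (huniv ▸ Set.mem_univ t) ht⟩
    obtain ⟨r₁, r₂, h₁, h₂, h12, hgen⟩ := exists_generators_compl h huniv
    suffices hnle : ¬ U r₁ ⊓ U r₂ ≤ B D by
      obtain ⟨u, hu, hu'⟩ := SetLike.not_le_iff_exists.1 hnle
      exact ⟨u, hX r₁ hu.1, hu', fun t ht => (hgen t ht).elim (fun e => hU e hu.1)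
        fun e => hU e hu.2⟩
    intro hle
    rcases h12 with rfl | ⟨hn1, hn2⟩
    · rw [inf_idem] at hle
      exact hXB ((hins r₁ h₁).trans (sup_le le_rfl hle))
    -- If U r₁ ∩ U r₂ lay in B D, then, each t ∈ D being below r₁ or r₂, X = B₁ + U r₂. As B₁ ≤ U
    -- r₁, the modular law would put U r₁ inside B D, forcing B D = X.
    set B₁ := B {t | t ∈ D ∧ t ≤ r₁} with hB₁
    have hB₁D : B₁ ≤ B D := sup_le le_sup_left (iSup₂_le fun t ht => hUB D t ht.1)
    have hB₁U : B₁ ≤ U r₁ := sup_le (hP r₁) (iSup₂_le fun t ht => hU ht.2)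
    have hBle : B D ≤ B₁ ⊔ U r₂ := by
      refine sup_le (le_sup_left.trans le_sup_left) (iSup₂_le fun t ht => ?_)
      rcases comparable_of_width_le_two h r₁ r₂ t with e | e | e | e | e | e
      · exact absurd e hn1
      · exact absurd e hn2
      · exact absurd (hD e ht) h₁.1
      · exact (hUB {t | t ∈ D ∧ t ≤ r₁} t ⟨ht, e⟩).trans le_sup_left
      · exact absurd (hD e ht) h₂.1
      · exact (hU e).trans le_sup_right
    have h1 : U r₁ ≤ B D := by
      have h2 : U r₁ ≤ B₁ ⊔ U r₂ :=
        (hX r₁).trans ((hins r₂ h₂).trans (sup_le hBle le_sup_right))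
      calc U r₁ = (B₁ ⊔ U r₂) ⊓ U r₁ := (inf_eq_right.2 h2).symm
        _ = B₁ ⊔ U r₂ ⊓ U r₁ := (sup_inf_assoc_of_le (U r₂) hB₁U)
        _ ≤ B D := sup_le hB₁D (inf_comm (U r₂) (U r₁) ▸ hle)
    exact hXB ((hins r₁ h₁).trans (sup_le le_rfl h1))
  obtain ⟨u, huX, huB, hu⟩ := hu
  obtain ⟨f, hfu, hf⟩ := Submodule.exists_le_ker_of_notMem huB
  refine ⟨D, (f u)⁻¹ • f, u, hD, huX, by simp [hfu], ?_, fun t ht => ?_, hu⟩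
  · intro x hx
    have : f x = 0 := hf (le_sup_left (a := P) hx)
    simp [this]
  · intro x hx
    have : f x = 0 := hf (hUB D t ht hx)
    simp [this]

end Width

/-! ### The derived space -/

namespace Space

variable {k : Type u} [Field k] {S : Type v} [PartialOrder S]

/-- The `S^p`-space on `V(p)` whose value at an antichain `A` is `V(p) ∩ ∑ a ∈ A, V(a)`. -/
def derived (p : S) (V : Space k S) : Space k (derivedPoset p) where
  ambient := V.sub p
  sub A := (⨆ a ∈ A.1.carrier, V.sub a).comap (V.sub p).subtype
  mono {A B} hAB := Submodule.comap_mono <| iSup₂_le fun a ha => by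
    obtain ⟨b, hb, hab⟩ := hAB a ha
    exact (V.mono hab).trans (le_iSup₂ (f := fun b (_ : b ∈ B.1.carrier) => V.sub b) b hb)

/-- Induction on X, starting from V(p): `exists_splitting` cuts X down to the hyperplane X ∩ ker φ,
and one new value has to be chosen off that hyperplane. Only the restriction of f to V(p) matters.
-/
theorem exists_extension_aux [Finite S] {p : S} (hw : width ((Set.Iic p)ᶜ : Set S) ≤ 2)
    (V Y : Space k S) (f : V.ambient →ₗ[k] Y.ambient) (hfp : ∀ v ∈ V.sub p, f v ∈ Y.sub p)
    (hf : ∀ A ∈ derivedPoset p, ∀ v ∈ V.sub p, v ∈ ⨆ a ∈ A.carrier, V.sub a →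
      f v ∈ ⨆ a ∈ A.carrier, Y.sub a)
    (X : Submodule k V.ambient) (hX : V.sub p ≤ X) :
    ∃ g : V.ambient →ₗ[k] Y.ambient, (∀ v ∈ V.sub p, g v = f v) ∧
      ∀ s, ∀ v ∈ V.sub s, v ∈ X → g v ∈ Y.sub s := by
  have base : ∀ s, ∀ v ∈ V.sub s, v ∈ V.sub p → f v ∈ Y.sub s := by
    intro s v hv hvp
    by_cases hps : p ≤ s
    · exact Y.mono hps (hfp v hvp)
    · have hs : JoinAntichain.single s ∈ derivedPoset p := by
        by_cases hsp : s ≤ p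
        · exact Or.inl ⟨s, ⟨hsp, fun e => hps (Eq.ge e)⟩, rfl⟩
        · refine Or.inr ?_
          rintro x rfl (h | h)
          · exact hsp h
          · exact hps h
      simpa [JoinAntichain.single] using hf _ hs v hvp (by simpa [JoinAntichain.single] using hv)
  induction X using WellFoundedLT.induction with
  | _ X ih =>
  rcases hX.eq_or_lt with rfl | hlt
  · exact ⟨f, fun _ _ => rfl, base⟩
  obtain ⟨D, φ, u, hD, huX, hφu, hPφ, hDφ, hu⟩ := exists_splitting hw hlt
    (U := fun t : ((Set.Iic p)ᶜ : Set S) => V.sub t ⊓ X ⊔ V.sub p)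
    (fun s t hst => sup_le_sup_right (inf_le_inf_right _ (V.mono hst)) _)
    (fun _ => le_sup_right) (fun _ => sup_le inf_le_right hX)
  have hlt' : X ⊓ LinearMap.ker φ < X := by
    refine lt_of_le_of_ne inf_le_left fun e => ?_
    have h0 : φ u = 0 := (inf_eq_left.1 e) huX
    exact one_ne_zero (hφu.symm.trans h0)
  obtain ⟨g₀, hg₀f, hg₀⟩ := ih _ hlt' (le_inf hX hPφ)
  have lift : ∀ r, r ∉ D → ∃ v ∈ V.sub r, v ∈ X ∧ u - v ∈ V.sub p := by
    intro r hr
    obtain ⟨v, hv, x, hx, hvx⟩ := Submodule.mem_sup.1 (hu r hr)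
    exact ⟨v, hv.1, hv.2, by rw [← hvx]; simpa using hx⟩
  -- y is to be the value of the extension at v, a vector congruent to u modulo V(p). For each r
  -- outside D some v' ∈ V(r) congruent to v must then go into Y(r); as v' - v lies in V(p), its
  -- image is already fixed by f.
  have claim : ∃ v y, u - v ∈ V.sub p ∧ ∀ r, r ∉ D →
      ∃ v' ∈ V.sub r, v' ∈ X ∧ v' - v ∈ V.sub p ∧ y + f (v' - v) ∈ Y.sub r := by
    by_cases huniv : D = Set.univ
    · exact ⟨u, 0, by simp, fun r hr => absurd (huniv ▸ Set.mem_univ r) hr⟩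
    obtain ⟨r₁, r₂, h₁, h₂, h12, hgen⟩ := exists_generators_compl hw huniv
    rcases h12 with rfl | ⟨hn1, hn2⟩
    · obtain ⟨v, hv, hvX, huv⟩ := lift r₁ h₁.1
      refine ⟨v, 0, huv, fun r hr => ⟨v, V.mono ((hgen r hr).elim id id) hv, hvX, ?_, ?_⟩⟩ <;> simp
    obtain ⟨v₁, hv₁, hvX₁, huv₁⟩ := lift r₁ h₁.1
    obtain ⟨v₂, hv₂, hvX₂, huv₂⟩ := lift r₂ h₂.1
    have h21 : v₂ - v₁ ∈ V.sub p := by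
      have := sub_mem huv₁ huv₂
      rwa [sub_sub_sub_cancel_left] at this
    -- The difference lies in V(p) ∩ (V(r₁) + V(r₂)), the derived value at {r₁, r₂} unless p lies
    -- below one of the two.
    have hf21 : f (v₂ - v₁) ∈ Y.sub r₁ ⊔ Y.sub r₂ := by
      by_cases hp1 : p ≤ r₁
      · exact Submodule.mem_sup_left (Y.mono hp1 (hfp _ h21))
      by_cases hp2 : p ≤ r₂
      · exact Submodule.mem_sup_right (Y.mono hp2 (hfp _ h21))
      have hA : IsAntichain (· ≤ ·) ({(r₁ : S), (r₂ : S)} : Set S) := by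
        rintro x (rfl | rfl) y (rfl | rfl) hxy hle
        · exact hxy rfl
        · exact hn1 hle
        · exact hn2 hle
        · exact hxy rfl
      have := hf ⟨_, hA, Set.insert_nonempty _ _⟩ (Or.inr ?_) (v₂ - v₁) h21 ?_
      · simpa only [iSup_insert, iSup_singleton] using this
      · rintro x (rfl | rfl) (h | h)
        · exact r₁.2 h
        · exact hp1 h
        · exact r₂.2 h
        · exact hp2 h
      · simp only [iSup_insert, iSup_singleton]
        exact sub_mem (Submodule.mem_sup_right hv₂) (Submodule.mem_sup_left hv₁)
    obtain ⟨y₁, hy₁, y₂, hy₂, hy⟩ := Submodule.mem_sup.1 hf21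
    -- With f (v₂ - v₁) = y₁ + y₂, the value -y₁ at v₁ lies in Y(r₁) and makes the value at v₂ equal
    -- to y₂ ∈ Y(r₂).
    refine ⟨v₁, -y₁, huv₁, fun r hr => ?_⟩
    rcases hgen r hr with e | e
    · exact ⟨v₁, V.mono e hv₁, hvX₁, by simp, by simpa using Y.mono e hy₁⟩
    · exact ⟨v₂, V.mono e hv₂, hvX₂, h21, by rw [← hy]; simpa using Y.mono e hy₂⟩
  obtain ⟨v, y, huv, hv⟩ := claim
  have hφv : φ v = 1 := by
    have : φ (u - v) = 0 := hPφ huv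
    rw [map_sub, hφu, sub_eq_zero] at this
    exact this.symm
  -- This map agrees with g₀ on ker φ and sends v to y, because φ v = 1.
  refine ⟨g₀ + φ.smulRight (y - g₀ v), fun x hx => ?_, fun s x hxs hxX => ?_⟩
  · have : φ x = 0 := hPφ hx
    simp [this, hg₀f x hx]
  by_cases hsp : s ≤ p
  · have hxp := V.mono hsp hxs
    have : φ x = 0 := hPφ hxp
    simpa [this, hg₀f x hxp] using base s x hxs hxp
  by_cases hsD : (⟨s, hsp⟩ : ((Set.Iic p)ᶜ : Set S)) ∈ D
  · have h0 : φ x = 0 := hDφ _ hsD (Submodule.mem_sup_left ⟨hxs, hxX⟩)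
    simpa [h0] using hg₀ s x hxs ⟨hxX, h0⟩
  obtain ⟨v', hv's, hv'X, hv'v, hy⟩ := hv _ hsD
  have hφv' : φ v' = 1 := by
    have : φ (v' - v) = 0 := hPφ hv'v
    rw [map_sub, hφv, sub_eq_zero] at this
    exact this
  have h1 : g₀ (x - φ x • v') ∈ Y.sub s :=
    hg₀ s _ (sub_mem hxs (Submodule.smul_mem _ _ hv's))
      ⟨sub_mem hxX (Submodule.smul_mem _ _ hv'X), by simp [hφv']⟩
  have h2 : (g₀ + φ.smulRight (y - g₀ v)) x = g₀ (x - φ x • v') + φ x • (y + f (v' - v)) := by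
    rw [← hg₀f _ hv'v]
    simp only [LinearMap.add_apply, LinearMap.smulRight_apply, map_sub, map_smul, smul_sub,
      smul_add]
    abel
  rw [h2]
  exact add_mem h1 (Submodule.smul_mem _ _ hy)

/-- Every morphism between derived spaces is the restriction of a morphism. -/
theorem exists_extension [Finite S] {p : S} (hw : width ((Set.Iic p)ᶜ : Set S) ≤ 2)
    {V Y : Space k S} {f : V.sub p →ₗ[k] Y.sub p}
    (hf : IsMorphism (derived p V) (derived p Y) f) :
    ∃ g : V.ambient →ₗ[k] Y.ambient, IsMorphism V Y g ∧
      ∀ x : V.sub p, g x = f x := by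
  obtain ⟨F, hF⟩ := LinearMap.exists_extend (p := V.sub p) ((Y.sub p).subtype ∘ₗ f)
  have hF' : ∀ x : V.sub p, F x = f x := fun x =>
    LinearMap.congr_fun hF x
  obtain ⟨g, hg, hgs⟩ := exists_extension_aux hw V Y F
    (fun v hv => by rw [hF' ⟨v, hv⟩]; exact Subtype.prop _)
    (fun A hA v hv hvA => by
      rw [hF' ⟨v, hv⟩]
      exact hf ⟨A, hA⟩ ⟨⟨v, hv⟩, hvA, rfl⟩)
    ⊤ le_top
  refine ⟨g, fun s => ?_, fun x => (hg x x.2).trans (hF' x)⟩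
  rintro _ ⟨v, hv, rfl⟩
  exact hgs s v hv trivial

end Space
namespace Space

variable {k : Type u} [Field k] {S : Type v} [PartialOrder S]

/-! ### Morphisms, direct summands and the Fitting lemma -/

theorem Isomorphic.symm {U V : Space k S} (h : Isomorphic U V) : Isomorphic V U :=
  (isoSetoid k S).symm h

theorem Isomorphic.trans {U V W : Space k S} (h : Isomorphic U V) (h' : Isomorphic V W) :
    Isomorphic U W :=
  (isoSetoid k S).trans h h'

theorem IsMorphism.apply_mem {U V : Space k S} {f : U.ambient →ₗ[k] V.ambient}
    (hf : IsMorphism U V f) {s : S} {x : U.ambient} (hx : x ∈ U.sub s) : f x ∈ V.sub s :=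
  hf s ⟨x, hx, rfl⟩

theorem IsMorphism.comp {U V W : Space k S} {f : U.ambient →ₗ[k] V.ambient}
    {g : V.ambient →ₗ[k] W.ambient} (hg : IsMorphism V W g) (hf : IsMorphism U V f) :
    IsMorphism U W (g ∘ₗ f) := by
  rintro s _ ⟨x, hx, rfl⟩
  exact hg.apply_mem (hf.apply_mem hx)

theorem Isomorphic.isNonzero {U V : Space k S} (h : Isomorphic U V) (hU : U.IsNonzero) :
    V.IsNonzero := by
  obtain ⟨f, g, -, -, hgf, -⟩ := h
  have : Nontrivial U.ambient := hU
  have hinj : Function.Injective f :=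
    Function.LeftInverse.injective (g := g) fun x => LinearMap.congr_fun hgf x
  exact hinj.nontrivial

/-- By comparison of dimensions, both maps are bijective and match the subspaces at each s exactly.
-/
theorem isomorphic_of_injective {U V : Space k S} {f : U.ambient →ₗ[k] V.ambient}
    {g : V.ambient →ₗ[k] U.ambient} (hf : IsMorphism U V f) (hg : IsMorphism V U g)
    (hfi : Function.Injective f) (hgi : Function.Injective g) : Isomorphic U V := by
  have key : ∀ (A : Submodule k U.ambient) (B : Submodule k V.ambient), A.map f ≤ B →
      B.map g ≤ A → A.map f = B := by
    intro A B h1 h2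
    refine Submodule.eq_of_le_of_finrank_le h1 ?_
    rw [(Submodule.equivMapOfInjective g hgi B).finrank_eq,
      ← (Submodule.equivMapOfInjective f hfi A).finrank_eq]
    exact Submodule.finrank_mono h2
  have hsurj : Function.Surjective f := by
    rw [← LinearMap.range_eq_top, ← Submodule.map_top]
    exact key ⊤ ⊤ le_top le_top
  let e := LinearEquiv.ofBijective f ⟨hfi, hsurj⟩
  refine ⟨f, e.symm, hf, fun s => ?_, ?_, ?_⟩
  · rintro _ ⟨y, hy, rfl⟩
    rw [← key _ _ (hf s) (hg s)] at hy
    obtain ⟨x, hx, rfl⟩ := hy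
    have : e.symm (f x) = x := e.symm_apply_apply x
    change e.symm (f x) ∈ _
    rwa [this]
  · ext x
    exact e.symm_apply_apply x
  · ext x
    exact e.apply_symm_apply x

/-- The `S`-space induced on a subspace of the ambient space. -/
def restrict (V : Space k S) (X : Submodule k V.ambient) : Space k S where
  ambient := X
  sub s := (V.sub s).comap X.subtype
  mono h := Submodule.comap_mono (V.mono h)

theorem isomorphic_directSum_restrict (V : Space k S) {X Y : Submodule k V.ambient}
    (h : IsCompl X Y) (hs : ∀ s, V.sub s ≤ V.sub s ⊓ X ⊔ V.sub s ⊓ Y) :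
    Isomorphic V (directSum (restrict V X) (restrict V Y)) := by
  let e := Submodule.prodEquivOfIsCompl X Y h
  refine ⟨e.symm.toLinearMap, e.toLinearMap, fun s => ?_, fun s => ?_, ?_, ?_⟩
  · rintro _ ⟨v, hv, rfl⟩
    obtain ⟨x, hx, y, hy, rfl⟩ := Submodule.mem_sup.1 (hs s hv)
    have : e.symm (x + y) = ((⟨x, hx.2⟩ : X), (⟨y, hy.2⟩ : Y)) := by
      rw [LinearEquiv.symm_apply_eq]
      simp [e]
    change e.symm (x + y) ∈ _
    rw [this]
    exact ⟨hx.1, hy.1⟩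
  · rintro _ ⟨⟨(x : X), (y : Y)⟩, ⟨hx, hy⟩, rfl⟩
    have : e (x, y) = (x : V.ambient) + y := by simp [e]
    change e (x, y) ∈ _
    rw [this]
    exact add_mem hx hy
  · ext x
    exact e.apply_symm_apply x
  · exact LinearMap.ext fun x => e.symm_apply_apply x

theorem Indecomposable.eq_bot_or_eq_bot {V : Space k S} (hV : V.Indecomposable)
    {X Y : Submodule k V.ambient} (h : IsCompl X Y)
    (hs : ∀ s, V.sub s ≤ V.sub s ⊓ X ⊔ V.sub s ⊓ Y) : X = ⊥ ∨ Y = ⊥ := by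
  by_contra! hc
  exact hV.2 ⟨restrict V X, restrict V Y, Submodule.nontrivial_iff_ne_bot.2 hc.1,
    Submodule.nontrivial_iff_ne_bot.2 hc.2, isomorphic_directSum_restrict V h hs⟩

/-- Fitting's lemma: for large n the kernel and range of e ^ n are complementary, compatibly with
every V(s), so one of them is zero. -/
theorem Indecomposable.pow_eq_zero_or_injective [Finite S] {V : Space k S}
    (hV : V.Indecomposable) {e : Module.End k V.ambient} (he : IsMorphism V V e) :
    (∃ n, e ^ n = 0) ∨ Function.Injective e := by
  have hres : ∀ s, ∀ x ∈ V.sub s, e x ∈ V.sub s := fun s x hx => he.apply_mem hx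
  -- Finiteness of S allows a single n for e and all its restrictions to the V(s). The bound n ≥ 1
  -- lets injectivity pass from e ^ n to e.
  obtain ⟨n, ⟨hn1, hn⟩, hns⟩ := ((Filter.eventually_ge_atTop 1).and
    e.eventually_isCompl_ker_pow_range_pow |>.and <| Filter.eventually_all.2 fun s =>
      (e.restrict (hres s)).eventually_isCompl_ker_pow_range_pow).exists
  have hpow : ∀ s (y : V.sub s), (((e.restrict (hres s)) ^ n) y : V.ambient) = (e ^ n) y :=
    fun s y => by rw [Module.End.pow_restrict, LinearMap.coe_restrict_apply]
  have hsplit : ∀ s, V.sub s ≤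
      V.sub s ⊓ LinearMap.ker (e ^ n) ⊔ V.sub s ⊓ LinearMap.range (e ^ n) := by
    intro s x hx
    have hx' : (⟨x, hx⟩ : V.sub s) ∈ LinearMap.ker ((e.restrict (hres s)) ^ n) ⊔
        LinearMap.range ((e.restrict (hres s)) ^ n) := by
      rw [(hns s).sup_eq_top]
      trivial
    obtain ⟨y, hy, z, ⟨w, rfl⟩, hyz⟩ := Submodule.mem_sup.1 hx'
    have hxy : (y : V.ambient) + (((e.restrict (hres s)) ^ n) w : V.sub s) = x :=
      congrArg Subtype.val hyz
    rw [← hxy]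
    refine add_mem (Submodule.mem_sup_left ⟨y.2, ?_⟩) (Submodule.mem_sup_right ⟨Subtype.prop _, ?_⟩)
    · rw [SetLike.mem_coe, LinearMap.mem_ker, ← hpow, LinearMap.mem_ker.1 hy]
      rfl
    · exact ⟨w, (hpow s w).symm⟩
  rcases hV.eq_bot_or_eq_bot hn hsplit with h | h
  · right
    rw [LinearMap.ker_eq_bot] at h
    obtain ⟨m, rfl⟩ := Nat.exists_eq_add_of_le' hn1
    rw [pow_succ] at h
    exact Function.Injective.of_comp (f := ⇑(e ^ m)) h
  · exact Or.inl ⟨n, LinearMap.range_eq_bot.1 h⟩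

theorem pow_apply_eq_self {M : Type*} [AddCommGroup M] [Module k M] {e : Module.End k M} {x : M}
    (h : e x = x) (n : ℕ) : (e ^ n) x = x := by
  rw [Module.End.pow_apply]
  exact Function.iterate_fixed h n

/-! ### Properties of the derived space -/

theorem IsMorphism.derived {p : S} {U V : Space k S} {f : U.ambient →ₗ[k] V.ambient}
    (hf : IsMorphism U V f) :
    IsMorphism (derived p U) (derived p V) (f.restrict fun _ hx => hf.apply_mem hx) := by
  rintro A _ ⟨(x : U.sub p), hx, rfl⟩
  have h : (⨆ a ∈ A.1.carrier, U.sub a).map f ≤ ⨆ a ∈ A.1.carrier, V.sub a := by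
    simp only [Submodule.map_iSup]
    exact iSup₂_mono fun a _ => hf a
  exact h ⟨x, hx, rfl⟩

theorem Isomorphic.derived {p : S} {U V : Space k S} (h : Isomorphic U V) :
    Isomorphic (derived p U) (derived p V) := by
  obtain ⟨f, g, hf, hg, hgf, hfg⟩ := h
  refine ⟨_, _, hf.derived, hg.derived, LinearMap.ext fun (x : U.sub p) => Subtype.ext ?_,
    LinearMap.ext fun (x : V.sub p) => Subtype.ext ?_⟩
  · exact LinearMap.congr_fun hgf x
  · exact LinearMap.congr_fun hfg x

theorem isMorphism_fst (U V : Space k S) :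
    IsMorphism (directSum U V) U (LinearMap.fst k U.ambient V.ambient) := by
  rintro s _ ⟨x, hx, rfl⟩
  exact hx.1

theorem isMorphism_snd (U V : Space k S) :
    IsMorphism (directSum U V) V (LinearMap.snd k U.ambient V.ambient) := by
  rintro s _ ⟨x, hx, rfl⟩
  exact hx.2

theorem isMorphism_inl (U V : Space k S) :
    IsMorphism U (directSum U V) (LinearMap.inl k U.ambient V.ambient) := by
  rintro s _ ⟨x, hx, rfl⟩
  exact ⟨hx, zero_mem _⟩

theorem isMorphism_inr (U V : Space k S) :
    IsMorphism V (directSum U V) (LinearMap.inr k U.ambient V.ambient) := by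
  rintro s _ ⟨x, hx, rfl⟩
  exact ⟨zero_mem _, hx⟩

theorem derived_directSum (p : S) (U V : Space k S) :
    Isomorphic (derived p (directSum U V)) (directSum (derived p U) (derived p V)) := by
  refine ⟨LinearMap.prod ((LinearMap.fst k U.ambient V.ambient).restrict
      fun _ hx => (isMorphism_fst U V).apply_mem hx)
      ((LinearMap.snd k U.ambient V.ambient).restrict
      fun _ hx => (isMorphism_snd U V).apply_mem hx),
    LinearMap.coprod ((LinearMap.inl k U.ambient V.ambient).restrict
      fun _ hx => (isMorphism_inl U V).apply_mem hx)
      ((LinearMap.inr k U.ambient V.ambient).restrict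
      fun _ hx => (isMorphism_inr U V).apply_mem hx), ?_, ?_, ?_, ?_⟩
  · rintro A _ ⟨x, hx, rfl⟩
    exact ⟨(isMorphism_fst U V).derived.apply_mem hx, (isMorphism_snd U V).derived.apply_mem hx⟩
  · rintro A _ ⟨⟨x, y⟩, ⟨hx, hy⟩, rfl⟩
    exact add_mem ((isMorphism_inl U V).derived.apply_mem hx)
      ((isMorphism_inr U V).derived.apply_mem hy)
  · refine LinearMap.ext fun x => Subtype.ext (Prod.ext ?_ ?_)
    · exact add_zero x.1.1
    · exact zero_add x.1.2
  · refine LinearMap.ext fun x => Prod.ext (Subtype.ext ?_) (Subtype.ext ?_)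
    · exact add_zero x.1.1
    · exact zero_add x.2.1

/-! ### Indecomposability and isomorphism under derivation -/

variable [Finite S] {p : S}

/-- The projection onto a proper summand of the derived space extends to an endomorphism of V. It
fixes a nonzero vector and kills another, so it is neither nilpotent nor injective. -/
theorem Indecomposable.derived (hw : width ((Set.Iic p)ᶜ : Set S) ≤ 2) {V : Space k S}
    (hV : V.Indecomposable) (hp : V.sub p ≠ ⊥) : (derived p V).Indecomposable := by
  refine ⟨Submodule.nontrivial_iff_ne_bot.2 hp, ?_⟩
  rintro ⟨U, W, hU, hW, (a : V.sub p →ₗ[k] U.ambient × W.ambient),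
    (b : U.ambient × W.ambient →ₗ[k] V.sub p), ha, hb, hba, hab⟩
  have hab' : ∀ x, a (b x) = x := fun x => LinearMap.congr_fun hab x
  obtain ⟨e, he, hext⟩ := exists_extension hw
    ((hb.comp (isMorphism_inl U W)).comp ((isMorphism_fst U W).comp ha))
  have hfix : ∀ x, b (LinearMap.inl k U.ambient W.ambient (a x).1) = x →
      e (x : V.sub p) = (x : V.sub p) := fun x hx => (hext x).trans (congrArg Subtype.val hx)
  have hzero : ∀ x, b (LinearMap.inl k U.ambient W.ambient (a x).1) = 0 →
      e (x : V.sub p) = 0 := fun x hx => (hext x).trans (congrArg Subtype.val hx)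
  rcases hV.pow_eq_zero_or_injective he with ⟨n, hn⟩ | hinj
  · have : Nontrivial U.ambient := hU
    obtain ⟨u, hu⟩ := exists_ne (0 : U.ambient)
    have h1 := pow_apply_eq_self (hfix (b (u, 0)) (by rw [hab']; rfl)) n
    rw [hn] at h1
    have h2 : b (u, 0) = 0 := Subtype.ext h1.symm
    have h3 := hab' (u, 0)
    rw [h2, map_zero] at h3
    exact hu (congrArg Prod.fst h3).symm
  · have : Nontrivial W.ambient := hW
    obtain ⟨w, hw⟩ := exists_ne (0 : W.ambient)
    have h1 := hzero (b (0, w)) (by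
      rw [hab']
      exact (congrArg b (Prod.ext rfl rfl)).trans b.map_zero)
    have h2 : b (0, w) = 0 := Subtype.ext (hinj (h1.trans (map_zero e).symm))
    have h3 := hab' (0, w)
    rw [h2, map_zero] at h3
    exact hw (congrArg Prod.snd h3).symm

/-- Extend both isomorphisms. The composites fix the nonzero spaces at p pointwise, hence are not
nilpotent, hence are injective. -/
theorem Indecomposable.isomorphic_of_derived (hw : width ((Set.Iic p)ᶜ : Set S) ≤ 2)
    {V Y : Space k S} (hV : V.Indecomposable) (hY : Y.Indecomposable) (hVp : V.sub p ≠ ⊥)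
    (hYp : Y.sub p ≠ ⊥) (h : Isomorphic (Space.derived p V) (Space.derived p Y)) :
    Isomorphic V Y := by
  have key : ∀ {V : Space k S}, V.Indecomposable → V.sub p ≠ ⊥ → ∀ e : Module.End k V.ambient,
      IsMorphism V V e → (∀ x ∈ V.sub p, e x = x) → Function.Injective e := by
    intro V hV hVp e he hfix
    refine (hV.pow_eq_zero_or_injective he).resolve_left ?_
    rintro ⟨n, hn⟩
    obtain ⟨x, hx, hx0⟩ := Submodule.exists_mem_ne_zero_of_ne_bot hVp
    have := pow_apply_eq_self (hfix x hx) n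
    rw [hn] at this
    exact hx0 this.symm
  obtain ⟨f, g, hf, hg, hgf, hfg⟩ := h
  obtain ⟨F, hF, hFf⟩ := exists_extension hw hf
  obtain ⟨G, hG, hGg⟩ := exists_extension hw hg
  have h1 : Function.Injective (G ∘ₗ F) := key hV hVp _ (hG.comp hF) fun x hx => by
    rw [LinearMap.comp_apply, hFf ⟨x, hx⟩, hGg]
    exact congrArg Subtype.val (LinearMap.congr_fun hgf ⟨x, hx⟩)
  have h2 : Function.Injective (F ∘ₗ G) := key hY hYp _ (hF.comp hG) fun x hx => by
    rw [LinearMap.comp_apply, hGg ⟨x, hx⟩, hFf]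
    exact congrArg Subtype.val (LinearMap.congr_fun hfg ⟨x, hx⟩)
  exact isomorphic_of_injective hF hG (Function.Injective.of_comp (f := ⇑G) h1)
    (Function.Injective.of_comp (f := ⇑F) h2)

end Space

/-- The width bound leaves at most two elements; s = t encodes singletons, including the elements
strictly below p. -/
theorem carrier_eq_pair_of_mem_derivedPoset {S : Type v} [PartialOrder S] {p : S}
    (hw : width ((Set.Iic p)ᶜ : Set S) ≤ 2) {A : JoinAntichain S} (hA : A ∈ derivedPoset p) :
    ∃ s t, A.carrier = {s, t} ∧ ¬ p ≤ s ∧ ¬ p ≤ t ∧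
      (s = t ∨ (¬ s ≤ t ∧ ¬ t ≤ s ∧ ¬ s ≤ p ∧ ¬ t ≤ p)) := by
  rcases hA with ⟨s, ⟨hsp, hs⟩, rfl⟩ | hA
  · have : ¬ p ≤ s := fun e => hs (le_antisymm hsp e)
    exact ⟨s, s, by simp [JoinAntichain.single], this, this, Or.inl rfl⟩
  obtain ⟨s, hs⟩ := A.nonempty
  have hp : ∀ x ∈ A.carrier, ¬ x ≤ p ∧ ¬ p ≤ x := fun x hx =>
    ⟨fun e => hA hx (Or.inl e), fun e => hA hx (Or.inr e)⟩
  by_cases h : ∀ x ∈ A.carrier, x = s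
  · refine ⟨s, s, ?_, (hp s hs).2, (hp s hs).2, Or.inl rfl⟩
    ext x
    simp only [Set.mem_insert_iff, Set.mem_singleton_iff, or_self]
    exact ⟨h x, fun e => e ▸ hs⟩
  push Not at h
  obtain ⟨t, ht, hts⟩ := h
  have hst := A.isAntichain hs ht hts.symm
  have hts' := A.isAntichain ht hs hts
  refine ⟨s, t, ?_, (hp s hs).2, (hp t ht).2, Or.inr ⟨hst, hts', (hp s hs).1, (hp t ht).1⟩⟩
  ext x
  simp only [Set.mem_insert_iff, Set.mem_singleton_iff]
  refine ⟨fun hx => ?_, ?_⟩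
  · rcases comparable_of_width_le_two hw ⟨s, (hp s hs).1⟩ ⟨t, (hp t ht).1⟩ ⟨x, (hp x hx).1⟩ with
      e | e | e | e | e | e
    · exact absurd e hst
    · exact absurd e hts'
    · exact Or.inl (A.isAntichain.eq hs hx e).symm
    · exact Or.inl (A.isAntichain.eq hx hs e)
    · exact Or.inr (A.isAntichain.eq ht hx e).symm
    · exact Or.inr (A.isAntichain.eq hx ht e)
  · rintro (rfl | rfl)
    · exact hs
    · exact ht

namespace Space

variable {k : Type u} [Field k] {S : Type v} [PartialOrder S] {p : S}

/-! ### A right inverse of the derivation -/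

/-- The sum of all `W(A)` with `A ≤ {a, b}`. -/
def pairSub (W : Space k (derivedPoset p)) (a b : S) : Submodule k W.ambient :=
  ⨆ (A : derivedPoset p) (_ : ∀ x ∈ A.1.carrier, x ≤ a ∨ x ≤ b), W.sub A

theorem pairSub_mono (W : Space k (derivedPoset p)) {a b c d : S} (ha : a ≤ c ∨ a ≤ d)
    (hb : b ≤ c ∨ b ≤ d) : pairSub W a b ≤ pairSub W c d := by
  refine iSup₂_le fun A hA => le_iSup₂_of_le A (fun x hx => ?_) le_rfl
  rcases hA x hx with h | h
  · exact ha.imp h.trans h.trans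
  · exact hb.imp h.trans h.trans

theorem pairSub_eq (W : Space k (derivedPoset p)) {s t : S} {A : derivedPoset p}
    (hA : A.1.carrier = {s, t}) : pairSub W s t = W.sub A := by
  refine le_antisymm (iSup₂_le fun B hB => W.mono fun x hx => ?_) ?_
  · rcases hB x hx with h | h
    · exact ⟨s, by simp [hA], h⟩
    · exact ⟨t, by simp [hA], h⟩
  · refine le_iSup₂_of_le A (fun x hx => ?_) le_rfl
    rw [hA] at hx
    rcases hx with rfl | rfl
    · exact Or.inl le_rfl
    · exact Or.inr le_rfl

open Classical in
/-- The part of the space attached to `s` inside the original ambient space. -/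
noncomputable def baseSub (W : Space k (derivedPoset p)) (s : S) : Submodule k W.ambient :=
  if p ≤ s then ⊤ else pairSub W s s

theorem pairSub_le_baseSub (W : Space k (derivedPoset p)) {a b s : S} (ha : a ≤ s) (hb : b ≤ s) :
    pairSub W a b ≤ baseSub W s := by
  unfold baseSub
  split_ifs
  · exact le_top
  · exact pairSub_mono W (Or.inl ha) (Or.inl hb)

theorem baseSub_mono (W : Space k (derivedPoset p)) {s t : S} (h : s ≤ t) :
    baseSub W s ≤ baseSub W t := by
  by_cases ht : p ≤ t
  · simp [baseSub, ht]
  · have hs : ¬ p ≤ s := fun e => ht (e.trans h)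
    simp only [baseSub, ht, hs, if_false]
    exact pairSub_mono W (Or.inl h) (Or.inl h)

open Classical in
/-- The sum of those coordinates of `φ` whose second index, but not first index, lies
below `s`. -/
noncomputable def twist {M : Type*} [AddCommGroup M] [Module k M] {n : ℕ} (l r : Fin n → S)
    (s : S) : (Fin n → M) →ₗ[k] M :=
  ∑ i, if r i ≤ s ∧ ¬ l i ≤ s then LinearMap.proj i else 0

open Classical in
theorem twist_apply {M : Type*} [AddCommGroup M] [Module k M] {n : ℕ} (l r : Fin n → S)
    (s : S) (φ : Fin n → M) :
    twist (k := k) l r s φ = ∑ i, if r i ≤ s ∧ ¬ l i ≤ s then φ i else 0 := by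
  rw [twist, LinearMap.sum_apply]
  refine Finset.sum_congr rfl fun i _ => ?_
  split_ifs <;> rfl

/-- The subspace at `s` of the thickening: it is generated by the base part, by the vectors
`e i w` with `l i ≤ s` and by the vectors `w + e i w` with `r i ≤ s`, where `w` ranges over the
sum of the `W(A)` with `A ≤ {l i, r i}`. -/
noncomputable def thickenSub (W : Space k (derivedPoset p)) {n : ℕ} (l r : Fin n → S) (s : S) :
    Submodule k (W.ambient × (Fin n → W.ambient)) where
  -- Indices with both l i and r i below s need no correction: there x.2 i already lies in `baseSub
  -- W s`.
  carrier := {x | (∀ i, x.2 i ∈ pairSub W (l i) (r i)) ∧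
    (∀ i, ¬ l i ≤ s → ¬ r i ≤ s → x.2 i = 0) ∧ x.1 - twist (k := k) l r s x.2 ∈ baseSub W s}
  add_mem' {x y} hx hy := by
    refine ⟨fun i => add_mem (hx.1 i) (hy.1 i), fun i h1 h2 => ?_, ?_⟩
    · simp [hx.2.1 i h1 h2, hy.2.1 i h1 h2]
    · have := add_mem hx.2.2 hy.2.2
      rwa [sub_add_sub_comm, ← map_add] at this
  zero_mem' := by simp
  smul_mem' c x hx := by
    refine ⟨fun i => Submodule.smul_mem _ c (hx.1 i), fun i h1 h2 => ?_, ?_⟩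
    · simp [hx.2.1 i h1 h2]
    · have := Submodule.smul_mem _ c hx.2.2
      rwa [smul_sub, ← map_smul] at this

/-- An `S`-space whose derived space is a given `S^p`-space, provided that the pairs `(l i, r i)`
exhaust the incomparable pairs outside `(p)`. -/
noncomputable def thicken (W : Space k (derivedPoset p)) {n : ℕ} (l r : Fin n → S) :
    Space k S where
  ambient := W.ambient × (Fin n → W.ambient)
  sub := thickenSub W l r
  mono {s t} hst := by
    classical
    rintro ⟨w, φ⟩ ⟨h1, h2, h3⟩
    refine ⟨h1, fun i hl hr => h2 i (fun e => hl (e.trans hst)) (fun e => hr (e.trans hst)), ?_⟩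
    have h4 : twist (k := k) l r s φ - twist (k := k) l r t φ ∈ baseSub W t := by
      rw [twist_apply, twist_apply, ← Finset.sum_sub_distrib]
      refine sum_mem fun i _ => ?_
      by_cases hlt : l i ≤ t ∧ r i ≤ t
      · refine pairSub_le_baseSub W hlt.1 hlt.2 (sub_mem ?_ ?_) <;> split_ifs <;>
          first | exact h1 i | exact zero_mem _
      · have hz : ¬ l i ≤ s → ¬ r i ≤ s → φ i = 0 := h2 i
        have hlst : l i ≤ s → l i ≤ t := fun e => e.trans hst
        have hrst : r i ≤ s → r i ≤ t := fun e => e.trans hst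
        have : (if r i ≤ s ∧ ¬ l i ≤ s then φ i else 0) -
            (if r i ≤ t ∧ ¬ l i ≤ t then φ i else 0) = 0 := by
          split_ifs with c1 c2 c2
          · exact sub_self _
          · exact absurd ⟨not_not.1 fun e => c2 ⟨hrst c1.1, e⟩, hrst c1.1⟩ hlt
          · rw [hz (fun e => c2.2 (hlst e)) fun e => c1 ⟨e, fun e' => c2.2 (hlst e')⟩, sub_self]
          · exact sub_self _
        rw [this]
        exact zero_mem _
    have := add_mem (baseSub_mono W hst h3) h4
    rwa [sub_add_sub_cancel] at this

variable (W : Space k (derivedPoset p)) {n : ℕ} (l r : Fin n → S)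

theorem mem_thickenSub_iff {s : S} (w : W.ambient) :
    (w, (0 : Fin n → W.ambient)) ∈ thickenSub W l r s ↔ w ∈ baseSub W s := by
  refine ⟨fun h => by simpa using h.2.2, fun h => ⟨fun i => zero_mem _, fun _ _ _ => rfl, ?_⟩⟩
  simpa using h

/-- The extra coordinate i exists to give w = (w + e i w) - e i w with one term at t and the other
at s. Nothing more enters the sum: a coordinate whose two indices are not both below s or t
contributes zero to the total twist. -/
theorem mem_sup_thickenSub_iff {s t : S} (hs : ¬ p ≤ s) (ht : ¬ p ≤ t)
    (hst : s = t ∨ (¬ s ≤ t ∧ ∃ i, l i = s ∧ r i = t)) (w : W.ambient) :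
    (w, (0 : Fin n → W.ambient)) ∈ thickenSub W l r s ⊔ thickenSub W l r t ↔
      w ∈ pairSub W s t := by
  classical
  constructor
  · intro h
    obtain ⟨⟨x, φ⟩, ⟨hx1, hx2, hx3⟩, ⟨y, ψ⟩, ⟨hy1, hy2, hy3⟩, hxy⟩ := Submodule.mem_sup.1 h
    obtain rfl : x + y = w := congrArg Prod.fst hxy
    have hψ : ∀ i, φ i + ψ i = 0 := fun i => congrFun (congrArg Prod.snd hxy) i
    have hbase : ∀ {q}, ¬ p ≤ q → q ≤ s ∨ q ≤ t → baseSub W q ≤ pairSub W s t := by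
      intro q hq hqst
      simp only [baseSub, hq, if_false]
      exact pairSub_mono W hqst hqst
    have h1 := add_mem (hbase hs (Or.inl le_rfl) hx3) (hbase ht (Or.inr le_rfl) hy3)
    have h2 : twist (k := k) l r s φ + twist (k := k) l r t ψ ∈ pairSub W s t := by
      rw [twist_apply, twist_apply, ← Finset.sum_add_distrib]
      refine sum_mem fun i _ => ?_
      by_cases hi : (l i ≤ s ∨ l i ≤ t) ∧ (r i ≤ s ∨ r i ≤ t)
      · refine pairSub_mono W hi.1 hi.2 (add_mem ?_ ?_) <;> split_ifs <;>
          first | exact hx1 i | exact hy1 i | exact zero_mem _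
      · have hx := hx2 i
        have hy := hy2 i
        have hxy' := hψ i
        have : (if r i ≤ s ∧ ¬ l i ≤ s then φ i else 0) +
            (if r i ≤ t ∧ ¬ l i ≤ t then ψ i else 0) = 0 := by
          by_cases c1 : l i ≤ s <;> by_cases c2 : l i ≤ t <;> by_cases c3 : r i ≤ s <;>
            by_cases c4 : r i ≤ t <;> simp_all
        rw [this]
        exact zero_mem _
    have := add_mem h1 h2
    simp only at this
    convert this using 1
    abel
  · intro h
    rcases hst with rfl | ⟨hst, i, rfl, rfl⟩
    · exact Submodule.mem_sup_left ((mem_thickenSub_iff W l r w).2 (by simpa [baseSub, hs] using h))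
    have hmem : ∀ j, (Pi.single i w : Fin n → W.ambient) j ∈ pairSub W (l j) (r j) := by
      intro j
      rcases eq_or_ne j i with rfl | hj
      · simpa using h
      · simp [hj]
    have h1 : ((0 : W.ambient), -(Pi.single i w : Fin n → W.ambient)) ∈ thickenSub W l r (l i) := by
      refine ⟨fun j => neg_mem (hmem j), fun j hl _ => ?_, ?_⟩
      · have hj : j ≠ i := fun e => hl (e ▸ le_rfl)
        simp [hj]
      · have : twist (k := k) l r (l i) (-(Pi.single i w : Fin n → W.ambient)) = 0 := by
          rw [twist_apply]
          refine Finset.sum_eq_zero fun j _ => ?_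
          rcases eq_or_ne j i with rfl | hj <;> simp [*]
        simp [this]
    have h2 : (w, (Pi.single i w : Fin n → W.ambient)) ∈ thickenSub W l r (r i) := by
      refine ⟨hmem, fun j _ hr => ?_, ?_⟩
      · have hj : j ≠ i := fun e => hr (e ▸ le_rfl)
        simp [hj]
      · have : twist (k := k) l r (r i) (Pi.single i w : Fin n → W.ambient) = w := by
          rw [twist_apply, Finset.sum_eq_single i]
          · simp [hst]
          · intro j _ hj
            simp [hj]
          · simp
        simp [this]
    have := add_mem (Submodule.mem_sup_left h1 :
      _ ∈ thickenSub W l r (l i) ⊔ thickenSub W l r (r i)) (Submodule.mem_sup_right h2)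
    simpa using this

/-- No l i or r i is below p, so all extra coordinates vanish at p and only W remains there. -/
theorem derived_thicken (hw : width ((Set.Iic p)ᶜ : Set S) ≤ 2) (hl : ∀ i, ¬ l i ≤ p)
    (hr : ∀ i, ¬ r i ≤ p) (hlr : ∀ s t, ¬ s ≤ p → ¬ t ≤ p → ∃ i, l i = s ∧ r i = t) :
    Isomorphic (derived p (thicken W l r)) W := by
  have hzero : ∀ x ∈ thickenSub W l r p, x.2 = 0 := fun x hx =>
    funext fun i => hx.2.1 i (hl i) (hr i)
  have hmem : ∀ (A : derivedPoset p) (w : W.ambient),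
      (w, (0 : Fin n → W.ambient)) ∈ ⨆ a ∈ A.1.carrier, thickenSub W l r a ↔ w ∈ W.sub A := by
    intro A w
    obtain ⟨s, t, hA, hs, ht, hst⟩ := carrier_eq_pair_of_mem_derivedPoset hw A.2
    rw [← pairSub_eq W hA, hA, iSup_insert, iSup_singleton]
    exact mem_sup_thickenSub_iff W l r hs ht
      (hst.imp_right fun h => ⟨h.1, hlr s t h.2.2.1 h.2.2.2⟩) w
  let f : thickenSub W l r p →ₗ[k] W.ambient :=
    LinearMap.fst k W.ambient (Fin n → W.ambient) ∘ₗ (thickenSub W l r p).subtype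
  let g : W.ambient →ₗ[k] thickenSub W l r p :=
    (LinearMap.inl k W.ambient (Fin n → W.ambient)).codRestrict _ fun w =>
      (mem_thickenSub_iff W l r w).2 (by simp [baseSub])
  refine ⟨f, g, fun A => ?_, fun A => ?_, ?_, ?_⟩
  · rintro _ ⟨(x : thickenSub W l r p), hx, rfl⟩
    refine (hmem A _).1 ?_
    have : ((x.1.1, 0) : W.ambient × (Fin n → W.ambient)) = x.1 :=
      Prod.ext rfl (hzero x.1 x.2).symm
    change (x.1.1, (0 : Fin n → W.ambient)) ∈ _
    rw [this]
    exact hx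
  · rintro _ ⟨w, hx, rfl⟩
    exact (hmem A w).2 hx
  · exact LinearMap.ext fun (x : thickenSub W l r p) => Subtype.ext
      (Prod.ext rfl (hzero x.1 x.2).symm)
  · rfl

theorem exists_isomorphic_derived [Finite S] (hw : width ((Set.Iic p)ᶜ : Set S) ≤ 2) :
    ∃ V : Space k S, Isomorphic (derived p V) W := by
  obtain ⟨n, ⟨e⟩⟩ := Finite.exists_equiv_fin ({s : S // ¬ s ≤ p} × {s : S // ¬ s ≤ p})
  refine ⟨_, derived_thicken W (fun i => (e.symm i).1) (fun i => (e.symm i).2) hw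
    (fun i => (e.symm i).1.2) (fun i => (e.symm i).2.2) fun s t hs ht => ?_⟩
  exact ⟨e (⟨s, hs⟩, ⟨t, ht⟩), by simp, by simp⟩

/-! ### Lifting indecomposables -/

theorem isNonzero_of_derived {V : Space k S} (h : (derived p V).IsNonzero) : V.IsNonzero := by
  have : Nontrivial (V.sub p) := h
  exact (V.sub p).subtype_injective.nontrivial

theorem isNonzero_iff_finrank {V : Space k S} : V.IsNonzero ↔ 0 < Module.finrank k V.ambient :=
  Module.finrank_pos_iff.symm

theorem finrank_eq_add {V X Y : Space k S} (h : Isomorphic V (directSum X Y)) :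
    Module.finrank k V.ambient = Module.finrank k X.ambient + Module.finrank k Y.ambient := by
  obtain ⟨f, g, -, -, hgf, hfg⟩ := h
  rw [(LinearEquiv.ofLinearMap f g hfg hgf).finrank_eq]
  exact Module.finrank_prod

theorem isomorphic_directSum_right {U V : Space k S} (hV : ¬ V.IsNonzero) :
    Isomorphic (directSum U V) U := by
  have : Subsingleton V.ambient := not_nontrivial_iff_subsingleton.1 hV
  refine ⟨_, _, isMorphism_fst U V, isMorphism_inl U V, ?_, ?_⟩
  · exact LinearMap.ext fun x => Prod.ext rfl (Subsingleton.elim _ _)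
  · rfl

theorem isomorphic_directSum_left {U V : Space k S} (hU : ¬ U.IsNonzero) :
    Isomorphic (directSum U V) V := by
  have : Subsingleton U.ambient := not_nontrivial_iff_subsingleton.1 hU
  refine ⟨_, _, isMorphism_snd U V, isMorphism_inr U V, ?_, ?_⟩
  · exact LinearMap.ext fun x => Prod.ext (Subsingleton.elim _ _) rfl
  · rfl

variable {W} in
-- A preimage of W of least dimension is indecomposable: if it split, one summand would have zero
-- derived space, and the other would be a smaller preimage.
theorem Indecomposable.exists_indecomposable_derived [Finite S]
    (hw : width ((Set.Iic p)ᶜ : Set S) ≤ 2) (hW : W.Indecomposable) :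
    ∃ V : Space k S, V.Indecomposable ∧ Isomorphic (Space.derived p V) W := by
  obtain ⟨V, hV, hmin⟩ := exists_minimalFor_of_wellFoundedLT
    (fun V : Space k S => Isomorphic (Space.derived p V) W)
    (fun V => Module.finrank k V.ambient) (exists_isomorphic_derived W hw)
  refine ⟨V, ⟨isNonzero_of_derived (hV.symm.isNonzero hW.1), ?_⟩, hV⟩
  rintro ⟨X, Y, hX, hY, hXY⟩
  have hsum := finrank_eq_add hXY
  rw [isNonzero_iff_finrank] at hX hY
  have hW' := (hV.symm.trans hXY.derived).trans (derived_directSum p X Y)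
  by_cases hX' : (Space.derived p X).IsNonzero
  · by_cases hY' : (Space.derived p Y).IsNonzero
    · exact hW.2 ⟨_, _, hX', hY', hW'⟩
    · have := @hmin X (hW'.trans (isomorphic_directSum_right hY')).symm
      simp only at this
      omega
  · have := @hmin Y (hW'.trans (isomorphic_directSum_left hX')).symm
    simp only at this
    omega

end Space

/-! ### Lower sets containing `p` and antichains outside `(p)` -/

section LowerSets

variable {S : Type v} [PartialOrder S]

instance JoinAntichain.finite [Finite S] : Finite (JoinAntichain S) :=
  Finite.of_injective JoinAntichain.carrier fun _ _ h => JoinAntichain.ext h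

/-- The lower set generated by `p` and by a possibly empty antichain outside `(p)`. -/
def generatedLowerSet (p : S) (o : Option (JoinAntichain ((Set.Iic p)ᶜ : Set S))) : Set S :=
  {s | s ≤ p ∨ ∃ A ∈ o, ∃ a ∈ A.carrier, s ≤ a}

theorem isLowerSet_generatedLowerSet (p : S) (o : Option (JoinAntichain ((Set.Iic p)ᶜ : Set S))) :
    IsLowerSet (generatedLowerSet p o) := by
  rintro s t hts (h | ⟨A, hA, a, ha, h⟩)
  · exact Or.inl (hts.trans h)
  · exact Or.inr ⟨A, hA, a, ha, hts.trans h⟩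

/-- Inclusion of the generated lower sets gives back the order on antichains, and antisymmetry
finishes. -/
theorem generatedLowerSet_injective (p : S) : Function.Injective (generatedLowerSet p) := by
  have key : ∀ (A : JoinAntichain ((Set.Iic p)ᶜ : Set S)) o,
      generatedLowerSet p (some A) ⊆ generatedLowerSet p o → ∃ B ∈ o, A ≤ B := by
    intro A o h
    have h' : ∀ a ∈ A.carrier, ∃ B ∈ o, ∃ b ∈ B.carrier, a ≤ b := fun a ha =>
      (h (Or.inr ⟨A, rfl, a, ha, le_rfl⟩ : (a : S) ∈ _)).resolve_left a.2
    obtain ⟨a, ha⟩ := A.nonempty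
    obtain ⟨B, hB, -⟩ := h' a ha
    refine ⟨B, hB, fun a ha => ?_⟩
    obtain ⟨B', hB', b, hb, hab⟩ := h' a ha
    obtain rfl := Option.mem_unique hB hB'
    exact ⟨b, hb, hab⟩
  rintro (_ | A) (_ | B) h
  · rfl
  · obtain ⟨_, h', -⟩ := key B none h.ge
    cases h'
  · obtain ⟨_, h', -⟩ := key A none h.le
    cases h'
  · obtain ⟨B', hB', hAB⟩ := key A (some B) h.le
    cases hB'
    obtain ⟨A', hA', hBA⟩ := key B (some A) h.ge
    cases hA'
    rw [le_antisymm hAB hBA]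

/-- The antichain consists of the maximal elements of D outside (p); it is `none` when there are
none. -/
theorem exists_generatedLowerSet_eq [Finite S] {p : S} {D : Set S} (hD : IsLowerSet D)
    (hp : p ∈ D) : ∃ o, generatedLowerSet p o = D := by
  by_cases h : ∃ t : ((Set.Iic p)ᶜ : Set S), (t : S) ∈ D
  · have key : ∀ t : ((Set.Iic p)ᶜ : Set S), (t : S) ∈ D →
        ∃ a, t ≤ a ∧ Maximal (fun x : ((Set.Iic p)ᶜ : Set S) => (x : S) ∈ D) a := fun t ht =>
      Finite.exists_le_maximal ht
    obtain ⟨t, ht⟩ := h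
    obtain ⟨b, -, hb⟩ := key t ht
    refine ⟨some ⟨{a | Maximal (fun x : ((Set.Iic p)ᶜ : Set S) => (x : S) ∈ D) a},
      setOfPred_maximal_antichain _, b, hb⟩, Set.Subset.antisymm ?_ fun s hs => ?_⟩
    · rintro s (hs | ⟨A, hA, a, ha, hs⟩)
      · exact hD hs hp
      · cases hA
        have ha' : Maximal (fun x : ((Set.Iic p)ᶜ : Set S) => (x : S) ∈ D) a := ha
        exact hD hs ha'.prop
    · by_cases hsp : s ≤ p
      · exact Or.inl hsp
      · obtain ⟨a, hsa, ha⟩ := key ⟨s, hsp⟩ hs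
        exact Or.inr ⟨_, rfl, a, ha, hsa⟩
  · push Not at h
    refine ⟨none, Set.Subset.antisymm ?_ fun s hs => ?_⟩
    · rintro s (hs | ⟨A, hA, -⟩)
      · exact hD hs hp
      · cases hA
    · exact Or.inl (not_not.1 fun e => h ⟨s, e⟩ hs)

end LowerSets

namespace Space

variable {k : Type u} [Field k] {S : Type v} [PartialOrder S]

/-! ### Indecomposable spaces that vanish at `p` -/

variable (k) in
open Classical in
/-- The one-dimensional space that vanishes exactly on the lower set `D`. -/
noncomputable def line (D : Set S) (hD : IsLowerSet D) : Space k S where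
  ambient := k
  sub s := if s ∈ D then ⊥ else ⊤
  mono {s t} hst := by
    by_cases ht : t ∈ D
    · rw [if_pos ht, if_pos (hD hst ht)]
    · rw [if_neg ht]
      exact le_top

theorem line_sub_eq_bot {D : Set S} (hD : IsLowerSet D) {s : S} (hs : s ∈ D) :
    (line k D hD).sub s = ⊥ := if_pos hs

theorem line_sub_eq_top {D : Set S} (hD : IsLowerSet D) {s : S} (hs : s ∉ D) :
    (line k D hD).sub s = ⊤ := if_neg hs

theorem line_indecomposable {D : Set S} (hD : IsLowerSet D) : (line k D hD).Indecomposable := by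
  have h1 : Module.finrank k (line k D hD).ambient = 1 := Module.finrank_self k
  refine ⟨isNonzero_iff_finrank.2 (h1 ▸ one_pos), ?_⟩
  rintro ⟨X, Y, hX, hY, hXY⟩
  have := finrank_eq_add hXY
  rw [isNonzero_iff_finrank] at hX hY
  omega

theorem Isomorphic.sub_eq_bot {U V : Space k S} (h : Isomorphic U V) {s : S}
    (hV : V.sub s = ⊥) : U.sub s = ⊥ := by
  obtain ⟨f, g, hf, -, hgf, -⟩ := h
  rw [Submodule.eq_bot_iff]
  intro x hx
  have h1 := hf.apply_mem hx
  rw [hV, Submodule.mem_bot] at h1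
  have h2 : g (f x) = x := LinearMap.congr_fun hgf x
  rw [← h2, h1, map_zero]

/-- D is recovered as the set where the space vanishes, an isomorphism invariant. -/
theorem eq_of_isomorphic_line {D E : Set S} {hD : IsLowerSet D} {hE : IsLowerSet E}
    (h : Isomorphic (line k D hD) (line k E hE)) : D = E := by
  have key : ∀ {D E : Set S} {hD : IsLowerSet D} {hE : IsLowerSet E},
      Isomorphic (line k D hD) (line k E hE) → E ⊆ D := by
    intro D E hD hE h s hs
    by_contra hsD
    have h1 := h.sub_eq_bot (line_sub_eq_bot hE hs)
    rw [line_sub_eq_top hD hsD] at h1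
    have : Nontrivial (line k D hD).ambient := (line_indecomposable hD).1
    exact top_ne_bot h1
  exact (key h.symm).antisymm (key h)

/-- Splitting the whole space relative to the zero subspace gives V = ker φ ⊕ ⟨u⟩ compatibly with
all V(s), so indecomposability forces ker φ = 0. -/
theorem Indecomposable.exists_isomorphic_line [Finite S] {p : S}
    (hw : width ((Set.Iic p)ᶜ : Set S) ≤ 2) {V : Space k S} (hV : V.Indecomposable)
    (hp : V.sub p = ⊥) : ∃ (D : Set S) (hD : IsLowerSet D), p ∈ D ∧ Isomorphic V (line k D hD) := by
  have : Nontrivial V.ambient := hV.1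
  obtain ⟨E, φ, u, hE, -, hφu, -, hEφ, hu⟩ := exists_splitting hw
    (bot_lt_top : (⊥ : Submodule k V.ambient) < ⊤)
    (U := fun t : ((Set.Iic p)ᶜ : Set S) => V.sub t) (fun s t hst => V.mono hst)
    (fun _ => bot_le) (fun _ => le_top)
  -- D is the union of E and (p).
  set D : Set S := {s | ∀ h : ¬ s ≤ p, (⟨s, h⟩ : ((Set.Iic p)ᶜ : Set S)) ∈ E} with hDdef
  have hD : IsLowerSet D := fun s t hts hs ht =>
    hE (a := ⟨s, fun e => ht (hts.trans e)⟩) hts (hs _)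
  have hDφ : ∀ s ∈ D, V.sub s ≤ LinearMap.ker φ := by
    intro s hs
    by_cases hsp : s ≤ p
    · exact ((V.mono hsp).trans hp.le).trans bot_le
    · exact hEφ _ (hs hsp)
  have huD : ∀ s ∉ D, u ∈ V.sub s := by
    intro s hs
    simp only [hDdef, Set.mem_ofPred_eq, not_forall] at hs
    obtain ⟨h, hs⟩ := hs
    exact hu _ hs
  have hker : ∀ v, v - φ v • u ∈ LinearMap.ker φ := fun v => by simp [hφu]
  have hcompl : IsCompl (LinearMap.ker φ) (Submodule.span k {u}) := by
    constructor
    · rw [Submodule.disjoint_def]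
      intro x hx hxu
      obtain ⟨c, rfl⟩ := Submodule.mem_span_singleton.1 hxu
      have : c = 0 := by simpa [hφu] using hx
      simp [this]
    · rw [codisjoint_iff, eq_top_iff]
      intro v _
      rw [← sub_add_cancel v (φ v • u)]
      exact add_mem (Submodule.mem_sup_left (hker v))
        (Submodule.mem_sup_right (Submodule.smul_mem _ _ (Submodule.mem_span_singleton_self u)))
  have hbot : LinearMap.ker φ = ⊥ := by
    refine (hV.eq_bot_or_eq_bot hcompl fun s v hv => ?_).resolve_right fun h => ?_
    · by_cases hs : s ∈ D
      · exact Submodule.mem_sup_left ⟨hv, hDφ s hs hv⟩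
      · have hus := Submodule.smul_mem _ (φ v) (huD s hs)
        rw [← sub_add_cancel v (φ v • u)]
        exact add_mem (Submodule.mem_sup_left ⟨sub_mem hv hus, hker v⟩) (Submodule.mem_sup_right
          ⟨hus, Submodule.smul_mem _ _ (Submodule.mem_span_singleton_self u)⟩)
    · rw [Submodule.span_singleton_eq_bot] at h
      rw [h, map_zero] at hφu
      exact zero_ne_one hφu
  refine ⟨D, hD, fun h => absurd le_rfl h, φ, LinearMap.toSpanSingleton k _ u, fun s => ?_,
    fun s => ?_, ?_, ?_⟩
  · by_cases hs : s ∈ D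
    · rintro _ ⟨v, hv, rfl⟩
      have : φ v = 0 := hDφ s hs hv
      change (φ v : (line k D hD).ambient) ∈ _
      exact this ▸ zero_mem ((line k D hD).sub s)
    · rw [line_sub_eq_top hD hs]
      exact le_top
  · by_cases hs : s ∈ D
    · rw [line_sub_eq_bot hD hs]
      exact (Submodule.map_bot _).le.trans bot_le
    · rintro _ ⟨c, -, rfl⟩
      exact Submodule.smul_mem _ _ (huD s hs)
  · ext v
    have := hker v
    rw [hbot, Submodule.mem_bot, sub_eq_zero] at this
    exact this.symm
  · refine LinearMap.ext fun (c : k) => ?_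
    change φ (c • u) = c
    simp [hφu]

end Space

/-! ### Counting isomorphism classes -/

section Counting

variable (k : Type u) [Field k] {S : Type v} [PartialOrder S] [Finite S] {p : S}

open Space

theorem mk_nonvanishing_classes (hw : width ((Set.Iic p)ᶜ : Set S) ≤ 2) :
    Cardinal.mk (Quotient.mk (isoSetoid k S) '' {V | V.Indecomposable ∧ V.sub p ≠ ⊥}) =
      nu k (derivedPoset p) := by
  let F : Quotient (isoSetoid k S) → Quotient (isoSetoid k (derivedPoset p)) :=
    Quotient.map (derived p) fun _ _ h => Isomorphic.derived h
  refine Cardinal.mk_congr (Set.BijOn.equiv F ⟨?_, ?_, ?_⟩)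
  · rintro _ ⟨V, ⟨hV, hp⟩, rfl⟩
    exact ⟨derived p V, hV.derived hw hp, rfl⟩
  · rintro _ ⟨V, ⟨hV, hVp⟩, rfl⟩ _ ⟨Y, ⟨hY, hYp⟩, rfl⟩ h
    exact Quotient.sound (hV.isomorphic_of_derived hw hY hVp hYp (Quotient.exact h))
  · rintro _ ⟨W, hW, rfl⟩
    obtain ⟨V, hV, hVW⟩ := Indecomposable.exists_indecomposable_derived hw hW
    exact ⟨_, ⟨V, ⟨hV, Submodule.nontrivial_iff_ne_bot.1 (hVW.symm.isNonzero hW.1)⟩, rfl⟩,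
      Quotient.sound hVW⟩

theorem mk_vanishing_classes (hw : width ((Set.Iic p)ᶜ : Set S) ≤ 2) :
    Cardinal.mk (Quotient.mk (isoSetoid k S) '' {V | V.Indecomposable ∧ V.sub p = ⊥}) =
      (Nat.card (JoinAntichain ((Set.Iic p)ᶜ : Set S)) : Cardinal) + 1 := by
  let F : Option (JoinAntichain ((Set.Iic p)ᶜ : Set S)) → Quotient (isoSetoid k S) := fun o =>
    Quotient.mk _ (line k (generatedLowerSet p o) (isLowerSet_generatedLowerSet p o))
  have hF : Function.Injective F := fun o o' h =>
    generatedLowerSet_injective p (eq_of_isomorphic_line (Quotient.exact h))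
  have hrange : Quotient.mk (isoSetoid k S) '' {V | V.Indecomposable ∧ V.sub p = ⊥} =
      Set.range F := by
    apply Set.Subset.antisymm
    · rintro _ ⟨V, ⟨hV, hp⟩, rfl⟩
      obtain ⟨D, hD, hpD, hVD⟩ := hV.exists_isomorphic_line hw hp
      obtain ⟨o, rfl⟩ := exists_generatedLowerSet_eq hD hpD
      exact ⟨o, Quotient.sound hVD.symm⟩
    · rintro _ ⟨o, rfl⟩
      exact ⟨_, ⟨line_indecomposable _, line_sub_eq_bot _ (Or.inl le_rfl)⟩, rfl⟩
  rw [hrange, ← Nat.cast_card, Nat.card_congr (Equiv.ofInjective F hF).symm, Finite.card_option,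
    Nat.cast_succ]

theorem nu_eq (hw : width ((Set.Iic p)ᶜ : Set S) ≤ 2) :
    nu k S = nu k (derivedPoset p) +
      (Nat.card (JoinAntichain ((Set.Iic p)ᶜ : Set S)) : Cardinal) + 1 := by
  have hunion : indecomposableClasses k S =
      (Quotient.mk (isoSetoid k S) '' {V | V.Indecomposable ∧ V.sub p ≠ ⊥}) ∪
        (Quotient.mk (isoSetoid k S) '' {V | V.Indecomposable ∧ V.sub p = ⊥}) := by
    rw [← Set.image_union, indecomposableClasses]
    congr 1
    ext V
    simp only [Set.mem_ofPred_eq, Set.mem_union]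
    tauto
  rw [nu, hunion, Cardinal.mk_union_of_disjoint, mk_nonvanishing_classes k hw,
    mk_vanishing_classes k hw, add_assoc]
  rw [Set.disjoint_left]
  rintro _ ⟨V, ⟨-, hV⟩, rfl⟩ ⟨Y, ⟨-, hY⟩, h⟩
  exact hV ((Isomorphic.symm (Quotient.exact h)).sub_eq_bot hY)

end Counting
end PosetRep

theorem mainTheorem4 (k : Type u) [Field k] (S : Type v) [PartialOrder S] [Finite S] (p : S)
    (hw : PosetRep.width ((Set.Iic p)ᶜ : Set S) ≤ 2) :
    PosetRep.nu k S =
        PosetRep.nu k (PosetRep.derivedPoset p) +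
          (Nat.card (PosetRep.JoinAntichain ((Set.Iic p)ᶜ : Set S)) : Cardinal) + 1 ∧
      (PosetRep.FinitelyRepresented k S ↔
        PosetRep.FinitelyRepresented k (PosetRep.derivedPoset p)) := by
  have h := PosetRep.nu_eq k hw
  refine ⟨h, ?_⟩
  rw [PosetRep.FinitelyRepresented, PosetRep.FinitelyRepresented, h, add_assoc,
    Cardinal.add_lt_aleph0_iff]
  refine and_iff_left ?_
  exact_mod_cast Cardinal.natCast_lt_aleph0
    (n := Nat.card (PosetRep.JoinAntichain ((Set.Iic p)ᶜ : Set S)) + 1)
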